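/- Fix a constant $p\in(0,1)$, and let $G_p\in\mathcal G_{n,p}$ denote the random graph on $n$ vertices in which every pair of vertices is joined by an edge independently with probability $p$. A property holds for almost all $G_p$ if its probability tends to $1$ as $n\to\infty$. Let $f:\mathbb R^2\to\mathbb R$ be a symmetric function such that $f((1+o(1))np,(1+o(1))np)=(1+o(1))f(np,np)$, that is: for all real sequences $(x_n),(y_n)$ with $x_n=(1+o(1))np$ and $y_n=(1+o(1))np$ as $n\to\infty$, one has $f(x_n,y_n)=(1+o(1))f(np,np)$. For a finite simple graph $G$ with vertex degrees $d_i$, let $A_f(G)$ be the weighted adjacency matrix, whose $(i,j)$ entry is $f(d_i,d_j)$ if $i$ and $j$ are adjacent and $0$ otherwise, let $D_f(G)$ be the diagonal matrix of the row sums of $A_f(G)$, and let $L_f(G)=D_f(G)-A_f(G)$ and $L_f^+(G)=D_f(G)+A_f(G)$. The weighted Laplacian-energy like invariant and the weighted incidence energy of $G$ are $$\mathscr{LEL}_f(G)=\sum_{i}\sqrt{|\lambda_i(L_f(G))|},\qquad \mathscr{IE}_f(G)=\sum_{i}\sqrt{|\lambda_i(L_f^+(G))|},$$ the sums being over all eigenvalues,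 counted with multiplicity. Then, for almost all $G_p\in\mathcal G_{n,p}$, $$\mathscr{LEL}_f(G_p)=\sqrt{|f(np,np)|}\,\bigl(\sqrt p+o(1)\bigr)\,n^{3/2},$$ $$\mathscr{IE}_f(G_p)=\sqrt{|f(np,np)|}\,\bigl(\sqrt p+o(1)\bigr)\,n^{3/2}.$$ Here each $o(1)$ is bounded in absolute value, with probability tending to $1$, by a deterministic sequence that tends to $0$. -/

import Mathlib

open Filter Topology Asymptotics

namespace WeightedGraph

noncomputable section

open Classical in
/-- The weighted adjacency matrix `A_f(G)`: the weight is `f(d_i, d_j)` at distance one (that is,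
for adjacent `i` and `j`), and all other entries are zero. -/
def adjMatrix {V : Type*} [Fintype V] (f : ℝ → ℝ → ℝ) (G : SimpleGraph V) : Matrix V V ℝ :=
  Matrix.of fun i j => if G.Adj i j then f (G.degree i) (G.degree j) else 0

/-- The diagonal matrix `D_f(G)`, with the row sums of `A_f(G)` on the diagonal
(the diagonal of `A_f(G)` is zero, so these are the sums over `j ≠ i`). -/
def degMatrix {V : Type*} [Fintype V] [DecidableEq V] (f : ℝ → ℝ → ℝ) (G : SimpleGraph V) :
    Matrix V V ℝ :=
  Matrix.diagonal fun i => ∑ j, adjMatrix f G i j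

/-- The weighted Laplacian matrix `L_f(G) = D_f(G) - A_f(G)`. -/
def lapMatrix {V : Type*} [Fintype V] [DecidableEq V] (f : ℝ → ℝ → ℝ) (G : SimpleGraph V) :
    Matrix V V ℝ :=
  degMatrix f G - adjMatrix f G

/-- The weighted signless Laplacian matrix `L_f⁺(G) = D_f(G) + A_f(G)`. -/
def signlessLapMatrix {V : Type*} [Fintype V] [DecidableEq V] (f : ℝ → ℝ → ℝ)
    (G : SimpleGraph V) : Matrix V V ℝ :=
  degMatrix f G + adjMatrix f G

theorem isHermitian_adjMatrix {V : Type*} [Fintype V] {f : ℝ → ℝ → ℝ}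
    (hf : ∀ x y, f x y = f y x) (G : SimpleGraph V) : (adjMatrix f G).IsHermitian := by
  refine Matrix.IsHermitian.ext fun i j => ?_
  by_cases h : G.Adj i j
  · simp only [adjMatrix, Matrix.of_apply, star_trivial, if_pos h, if_pos h.symm]
    exact hf _ _
  · have h2 : ¬ G.Adj j i := fun h2 => h h2.symm
    simp [adjMatrix, h, h2]

theorem isHermitian_degMatrix {V : Type*} [Fintype V] [DecidableEq V] (f : ℝ → ℝ → ℝ)
    (G : SimpleGraph V) : (degMatrix f G).IsHermitian :=
  Matrix.isHermitian_diagonal _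

theorem isHermitian_lapMatrix {V : Type*} [Fintype V] [DecidableEq V] {f : ℝ → ℝ → ℝ}
    (hf : ∀ x y, f x y = f y x) (G : SimpleGraph V) : (lapMatrix f G).IsHermitian :=
  (isHermitian_degMatrix f G).sub (isHermitian_adjMatrix hf G)

theorem isHermitian_signlessLapMatrix {V : Type*} [Fintype V] [DecidableEq V] {f : ℝ → ℝ → ℝ}
    (hf : ∀ x y, f x y = f y x) (G : SimpleGraph V) : (signlessLapMatrix f G).IsHermitian :=
  (isHermitian_degMatrix f G).add (isHermitian_adjMatrix hf G)

/-- The weighted Laplacian-energy like invariant: the sum of `√|λ|` over all eigenvalues `λ`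
of `L_f(G)`, counted with multiplicity. -/
def LEL {V : Type*} [Fintype V] [DecidableEq V] (f : ℝ → ℝ → ℝ) (hf : ∀ x y, f x y = f y x)
    (G : SimpleGraph V) : ℝ :=
  ∑ i, √|(isHermitian_lapMatrix hf G).eigenvalues i|

/-- The weighted incidence energy: the sum of `√|λ|` over all eigenvalues `λ` of `L_f⁺(G)`,
counted with multiplicity. -/
def IE {V : Type*} [Fintype V] [DecidableEq V] (f : ℝ → ℝ → ℝ) (hf : ∀ x y, f x y = f y x)
    (G : SimpleGraph V) : ℝ :=
  ∑ i, √|(isHermitian_signlessLapMatrix hf G).eigenvalues i|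

/-- Almost all `G_p ∈ 𝒢(n, p)` have the property `P`: the probability that the binomial
(Erdős–Rényi) random graph on `n` vertices has it tends to one as `n → ∞`. -/
def AlmostAll (p : unitInterval) (P : (n : ℕ) → SimpleGraph (Fin n) → Prop) : Prop :=
  Tendsto (fun n : ℕ => SimpleGraph.binomialRandom (Fin n) p {G | P n G}) atTop (𝓝 1)

/-- `f((1+o(1))np, (1+o(1))np) = (1+o(1)) f(np, np)` as `n → ∞`, for any two `o(1)` terms on the
left. Where `f(np, np)` vanishes, `IsEquivalent` asks the left side to vanish for large `n`. -/
def StableAt (f : ℝ → ℝ → ℝ) (p : ℝ) : Prop :=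
  ∀ x y : ℕ → ℝ, IsEquivalent atTop x (fun n : ℕ => n * p) →
    IsEquivalent atTop y (fun n : ℕ => n * p) →
      IsEquivalent atTop (fun n : ℕ => f (x n) (y n)) (fun n : ℕ => f (n * p) (n * p))

/-- For almost all `G_p ∈ 𝒢(n, p)`, `E(G_p) = √|f(np, np)| (√p + o(1)) n^{3/2}`: the error term
`δ` may depend on the graph, and is bounded by a null sequence `ε` that does not. -/
def HasAsymptotics (f : ℝ → ℝ → ℝ) (p : unitInterval)
    (E : (n : ℕ) → SimpleGraph (Fin n) → ℝ) : Prop :=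
  ∃ ε : ℕ → ℝ, Tendsto ε atTop (𝓝 0) ∧
    AlmostAll p fun n G => ∃ δ : ℝ, |δ| ≤ ε n ∧
      E n G = √|f (n * p) (n * p)| * (√(p : ℝ) + δ) * (n : ℝ) ^ (3 / 2 : ℝ)

end

end WeightedGraph

/-! Both matrices have the row sums of `adjMatrix` on the diagonal and ± its entries off it. Write F
= f(np, np) and m = Fnp. By Hoeffding and a union bound, almost surely in the limit all degrees lie
within 2n^{3/4} of np (`almostAll_nearRegular`). Stability of f is uniform on that window
(`StableAt.exists_uniform`), so diagonal entries are m + o(|F|n) and the others O(|F|). Expanding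
the trace of (A - m)² then gives ∑(λ - m)² = o(F²n³): the off-diagonal part contributes only
O(F²n²), whatever its signs. By Cauchy–Schwarz (`sq_sum_sqrt_abs_sub_mul_le`), ∑√|λ| = n√|m| +
o(√|F| n^{3/2}), and n√|m| is the main term. No finer spectral information is needed. -/

/-! ### Concentration of the degrees -/

open MeasureTheory ProbabilityTheory in
/-- Two-sided Hoeffding bound for a sum of `[0, 1]`-valued functions of independent random
propositions with a common mean. -/
theorem hoeffding_bernoulli_sum {ι : Type*} {P : ι → Measure Prop} [∀ i, IsProbabilityMeasure (P i)]
    {p : ℝ} (s : Finset ι) (X : ι → Prop → ℝ) (hX : ∀ i q, X i q ∈ Set.Icc (0 : ℝ) 1)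
    (hp : ∀ i ∈ s, ∫ q, X i q ∂(P i) = p) {t : ℝ} (ht : 0 ≤ t) :
    (Measure.infinitePi P).real {ω | t ≤ |∑ i ∈ s, X i (ω i) - s.card * p|} ≤
      2 * Real.exp (-(2 * t ^ 2 / s.card)) := by
  set μ := Measure.infinitePi P
  have hmean : ∀ i ∈ s, μ[fun ω => X i (ω i)] = p := by
    intro i hi
    rw [← hp i hi, ← Measure.infinitePi_map_eval P i,
      integral_map (measurable_pi_apply i).aemeasurable
        (measurable_of_countable (X i)).aestronglyMeasurable]
  have hsub : ∀ i ∈ s, HasSubgaussianMGF (fun ω : ι → Prop => X i (ω i) - p) (1 / 4) μ := by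
    intro i hi
    have h := hasSubgaussianMGF_of_mem_Icc (μ := μ) (X := fun ω : ι → Prop => X i (ω i))
      (a := 0) (b := 1)
      ((measurable_of_countable (X i)).comp (measurable_pi_apply i)).aemeasurable
      (Filter.Eventually.of_forall fun ω => hX i (ω i))
    rw [hmean i hi] at h
    convert h using 1
    ext; norm_num
  have hind : iIndepFun (fun i (ω : ι → Prop) => X i (ω i) - p) μ :=
    iIndepFun_infinitePi (P := P) (X := fun i q => X i q - p) fun i => measurable_of_countable _
  have hsum := HasSubgaussianMGF.sum_of_iIndepFun hind (c := fun _ => 1 / 4) hsub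
  have e : -(2 * t ^ 2 / (s.card : ℝ)) =
      -t ^ 2 / (2 * ((∑ i ∈ s, (1 / 4 : NNReal) : NNReal) : ℝ)) := by
    simp only [Finset.sum_const, nsmul_eq_mul]
    push_cast
    -- For empty `s` both exponents are 0, as division by zero gives 0.
    by_cases h : (s.card : ℝ) = 0
    · simp [h]
    · field_simp
      ring
  have h1 := hsum.measure_ge_le ht
  have h2 := hsum.neg.measure_ge_le ht
  rw [← e] at h1 h2
  have hsplit : {ω : ι → Prop | t ≤ |∑ i ∈ s, X i (ω i) - s.card * p|} ⊆
      {ω | t ≤ ∑ i ∈ s, (X i (ω i) - p)} ∪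
        {ω | t ≤ (-fun ω : ι → Prop => ∑ i ∈ s, (X i (ω i) - p)) ω} := by
    intro ω hω
    simp only [Set.mem_union, Set.mem_ofPred_eq, Pi.neg_apply, Finset.sum_sub_distrib,
      Finset.sum_const, nsmul_eq_mul] at hω ⊢
    exact le_abs.1 hω
  calc _ ≤ _ := measureReal_mono hsplit
    _ ≤ _ := measureReal_union_le _ _
    _ ≤ _ := by linarith

namespace WeightedGraph

open Classical in
/-- All degrees are within `2 n^{3/4}` of `np`. -/
def NearRegular (p : ℝ) (n : ℕ) (G : SimpleGraph (Fin n)) : Prop :=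
  ∀ i, |(G.degree i : ℝ) - n * p| ≤ 2 * (n : ℝ) ^ (3 / 4 : ℝ)

-- A degree is a sum of n - 1 independent edge indicators. Deviation t = n^{3/4} makes t²/(n - 1) ≥
-- √n, so the Hoeffding tail survives a union bound over n vertices.
open MeasureTheory ProbabilityTheory unitInterval in
theorem le_binomialRandom_nearRegular (p : unitInterval) {n : ℕ} (hn2 : 2 ≤ n) :
    ENNReal.ofReal (1 - n * (2 * Real.exp (-(2 * (n : ℝ) ^ (1 / 2 : ℝ))))) ≤
      SimpleGraph.binomialRandom (Fin n) p {G | NearRegular p n G} := by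
  classical
  rw [SimpleGraph.binomialRandom_eq_map, setBernoulli_eq_map,
    Measure.map_map (by fun_prop) (by fun_prop)]
  set P : Sym2 (Fin n) → Measure Prop := fun e =>
    toNNReal p • Measure.dirac (e ∈ (Sym2.diagSetᶜ : Set (Sym2 (Fin n)))) +
      toNNReal (σ p) • Measure.dirac False with hP
  have hprob : ∀ e, IsProbabilityMeasure (P e) := by
    intro e
    infer_instance
  -- This inequality requires no measurability of the target event.
  refine le_trans ?_ (Measure.le_map_apply (by fun_prop) _)
  set t : ℝ := (n : ℝ) ^ (3 / 4 : ℝ) with ht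
  have ht0 : 0 ≤ t := by positivity
  let s : Fin n → Finset (Sym2 (Fin n)) := fun i => (Finset.univ.erase i).image fun j => s(i, j)
  have hinj : ∀ i : Fin n, Function.Injective fun j => s(i, j) := fun i j k h => Sym2.congr_right.1 h
  have hcard : ∀ i, (s i).card = n - 1 := fun i => by
    rw [Finset.card_image_of_injective _ (hinj i), Finset.card_erase_of_mem (Finset.mem_univ i)]
    simp
  let X : Sym2 (Fin n) → Prop → ℝ := fun _ q => if q then 1 else 0
  let bad : Fin n → Set (Sym2 (Fin n) → Prop) := fun i =>
    {ω | t ≤ |∑ e ∈ s i, X e (ω e) - (s i).card * (p : ℝ)|}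
  have hbad : ∀ i, (Measure.infinitePi P).real (bad i) ≤
      2 * Real.exp (-(2 * (n : ℝ) ^ (1 / 2 : ℝ))) := by
    intro i
    have hn : 0 < n := Fin.pos i
    have hn' : (0 : ℝ) < n := by exact_mod_cast hn
    refine (hoeffding_bernoulli_sum (s i) X ?_ ?_ ht0).trans ?_
    · intro e q
      by_cases h : q <;> simp [X, h]
    · intro e he
      obtain ⟨j, hj, rfl⟩ := Finset.mem_image.1 he
      have hij : i ≠ j := fun h => by simp [h] at hj
      have hm : ∀ (q : Prop) (c : NNReal), Integrable (X s(i, j)) (c • Measure.dirac q) := by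
        intro q c
        refine Integrable.smul_measure_nnreal ?_
        exact integrable_dirac (by simp)
      rw [hP]
      dsimp only
      rw [integral_add_measure (hm _ _) (hm _ _), integral_smul_nnreal_measure,
        integral_smul_nnreal_measure, integral_dirac, integral_dirac]
      simp [X, hij, NNReal.smul_def]
    · have hc : (0 : ℝ) < (s i).card := by
        rw [hcard]; exact_mod_cast (by omega : 0 < n - 1)
      have hc' : ((s i).card : ℝ) ≤ n := by
        rw [hcard]; exact_mod_cast (by omega : n - 1 ≤ n)
      have : (n : ℝ) ^ (1 / 2 : ℝ) ≤ t ^ 2 / (s i).card := by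
        rw [le_div_iff₀ hc]
        calc (n : ℝ) ^ (1 / 2 : ℝ) * (s i).card ≤ (n : ℝ) ^ (1 / 2 : ℝ) * (n : ℝ) ^ (1 : ℝ) := by
              rw [Real.rpow_one]; gcongr
          _ = t ^ 2 := by
              rw [ht, ← Real.rpow_add hn', ← Real.rpow_natCast, ← Real.rpow_mul hn'.le]
              norm_num
      gcongr
      rw [mul_div_assoc]
      gcongr
  have hunion : (Measure.infinitePi P).real (⋃ i, bad i) ≤
      n * (2 * Real.exp (-(2 * (n : ℝ) ^ (1 / 2 : ℝ)))) := by
    refine (measureReal_iUnion_fintype_le _).trans ?_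
    refine (Finset.sum_le_sum fun i _ => hbad i).trans ?_
    simp
  have hsub : (⋃ i, bad i)ᶜ ⊆ SimpleGraph.fromEdgeSet ∘ (fun q : Sym2 (Fin n) → Prop => {e | q e}) ⁻¹'
      {G | NearRegular p n G} := by
    intro ω hω i
    simp only [Set.mem_compl_iff, Set.mem_iUnion, not_exists, bad, Set.mem_ofPred_eq, not_le] at hω
    have hi := hω i
    have hn : 0 < n := Fin.pos i
    have hdeg : ∑ e ∈ s i, X e (ω e) =
        ((SimpleGraph.fromEdgeSet {e | ω e}).degree i : ℝ) := by
      rw [Finset.sum_image fun j _ k _ h => hinj i h, ← SimpleGraph.card_neighborFinset_eq_degree,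
        Finset.sum_boole]
      congr 2
      ext j
      simp [and_comm, eq_comm]
    rw [hdeg, hcard, Nat.cast_pred hn] at hi
    -- The mean degree is (n - 1)p; the shift to np costs p ≤ 1 ≤ t, hence the factor 2 in
    -- `NearRegular`.
    have ht1 : 1 ≤ t := Real.one_le_rpow (by exact_mod_cast hn) (by norm_num)
    have hp0 := p.2.1
    have hp1 := p.2.2
    have hclose : |((SimpleGraph.fromEdgeSet {e | ω e}).degree i : ℝ) - n * p| ≤ 2 * t := by
      rw [abs_lt] at hi
      rw [abs_le]
      constructor <;> linarith
    convert hclose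
    rfl
  refine le_trans ?_ (measure_mono hsub)
  rw [← ofReal_measureReal]
  refine ENNReal.ofReal_le_ofReal ?_
  have := measureReal_union_le (μ := Measure.infinitePi P) (⋃ i, bad i) (⋃ i, bad i)ᶜ
  rw [Set.union_compl_self, probReal_univ] at this
  linarith

theorem almostAll_nearRegular (p : unitInterval) : AlmostAll p (NearRegular p) := by
  have h0 : Tendsto (fun n : ℕ => (n : ℝ) * (2 * Real.exp (-(2 * (n : ℝ) ^ (1 / 2 : ℝ)))))
      atTop (𝓝 0) := by
    have h1 := (tendsto_rpow_mul_exp_neg_mul_atTop_nhds_zero 2 2 (by norm_num)).comp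
      ((tendsto_rpow_atTop (by norm_num : (0 : ℝ) < 1 / 2)).comp tendsto_natCast_atTop_atTop)
    have h2 := h1.const_mul 2
    rw [mul_zero] at h2
    refine h2.congr fun n => ?_
    simp only [Function.comp]
    rw [← Real.rpow_mul (by positivity)]
    norm_num
    ring
  have h1 := ENNReal.tendsto_ofReal (h0.const_sub 1)
  rw [sub_zero, ENNReal.ofReal_one] at h1
  exact tendsto_of_tendsto_of_tendsto_of_le_of_le' h1 tendsto_const_nhds
    ((eventually_ge_atTop 2).mono fun _ hn => le_binomialRandom_nearRegular p hn)
    (Eventually.of_forall fun _ => MeasureTheory.prob_le_one)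

theorem AlmostAll.mono_eventually {p : unitInterval} {P Q : (n : ℕ) → SimpleGraph (Fin n) → Prop}
    (hP : AlmostAll p P) (h : ∀ᶠ n in atTop, ∀ G, P n G → Q n G) : AlmostAll p Q :=
  tendsto_of_tendsto_of_tendsto_of_le_of_le' hP tendsto_const_nhds
    (h.mono fun _ hn => MeasureTheory.measure_mono fun G hG => hn G hG)
    (Eventually.of_forall fun _ => MeasureTheory.prob_le_one)

end WeightedGraph

/-! ### Uniform stability of the weight function -/

/-- Diagonalisation: a family of upward closed properties, each holding eventually for every
positive parameter, holds eventually along some null sequence of parameters. -/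
theorem exists_null_seq_of_forall_pos {Q : ℕ → ℝ → Prop}
    (hmono : ∀ n a b, a ≤ b → Q n a → Q n b) (h : ∀ ε > 0, ∀ᶠ n in atTop, Q n ε) :
    ∃ e : ℕ → ℝ, (∀ n, 0 ≤ e n) ∧ Tendsto e atTop (𝓝 0) ∧ ∀ᶠ n in atTop, Q n (e n) := by
  have hinv : ∀ n : ℕ, (0 : ℝ) < 1 / ((n : ℝ) + 1) := fun n => Nat.one_div_pos_of_nat
  have hbdd : ∀ n, BddBelow {ε : ℝ | 0 < ε ∧ Q n ε} := fun n => ⟨0, fun _ hx => hx.1.le⟩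
  have hnn : ∀ n, 0 ≤ sInf {ε : ℝ | 0 < ε ∧ Q n ε} := fun n => Real.sInf_nonneg fun _ hx => hx.1.le
  -- The infimum need not be attained; the extra 1/(n + 1) puts the parameter strictly above an
  -- admissible one.
  refine ⟨fun n => sInf {ε : ℝ | 0 < ε ∧ Q n ε} + 1 / ((n : ℝ) + 1),
    fun n => add_nonneg (hnn n) (hinv n).le, ?_, ?_⟩
  · have : Tendsto (fun n => sInf {ε : ℝ | 0 < ε ∧ Q n ε}) atTop (𝓝 0) := by
      refine tendsto_order.2 ⟨fun a ha => Eventually.of_forall fun n => ha.trans_le (hnn n),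
        fun a ha => ?_⟩
      filter_upwards [h (a / 2) (half_pos ha)] with n hn
      exact (csInf_le (hbdd n) ⟨half_pos ha, hn⟩).trans_lt (half_lt_self ha)
    simpa using this.add tendsto_one_div_add_atTop_nhds_zero_nat
  · filter_upwards [h 1 one_pos] with n hn
    have hne : {ε : ℝ | 0 < ε ∧ Q n ε}.Nonempty := ⟨1, one_pos, hn⟩
    obtain ⟨x, hx, hlt⟩ := exists_lt_of_csInf_lt hne (lt_add_of_pos_right _ (hinv n))
    exact hmono n x _ hlt.le hx.2

namespace WeightedGraph

theorem isEquivalent_mul_of_abs_sub_le {p : ℝ} (hp : 0 < p) {x : ℕ → ℝ}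
    (hx : ∀ n : ℕ, |x n - n * p| ≤ 2 * (n : ℝ) ^ (3 / 4 : ℝ)) :
    IsEquivalent atTop x (fun n : ℕ => n * p) := by
  have h1 : (fun n : ℕ => x n - n * p) =O[atTop] fun n : ℕ => (n : ℝ) ^ (3 / 4 : ℝ) := by
    refine IsBigO.of_bound 2 (Eventually.of_forall fun n => ?_)
    rw [Real.norm_eq_abs, Real.norm_of_nonneg (by positivity)]
    exact hx n
  have h2 : (fun n : ℕ => (n : ℝ) ^ (3 / 4 : ℝ)) =o[atTop] fun n : ℕ => (n : ℝ) * p := by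
    have h3 : Tendsto (fun n : ℕ => (n : ℝ) ^ (-(1 / 4) : ℝ)) atTop (𝓝 0) :=
      (tendsto_rpow_neg_atTop (by norm_num)).comp tendsto_natCast_atTop_atTop
    have h4 := (isBigO_refl (fun n : ℕ => (n : ℝ) * p) atTop).mul_isLittleO
      ((isLittleO_one_iff ℝ).2 h3)
    refine (h4.const_mul_left p⁻¹).congr' ?_ (by simp)
    filter_upwards [eventually_gt_atTop 0] with n hn
    have hn' : (0 : ℝ) < n := by exact_mod_cast hn
    rw [show (3 / 4 : ℝ) = 1 + -(1 / 4) by norm_num, Real.rpow_one_add' hn'.le (by norm_num)]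
    field_simp
  exact h1.trans_isLittleO h2

/-- The convergence in `StableAt` is uniform over windows of width `n^{3/4}` around `np`. -/
theorem StableAt.exists_uniform {f : ℝ → ℝ → ℝ} {p : ℝ} (hp : 0 < p) (hf : StableAt f p) :
    ∃ e : ℕ → ℝ, (∀ n, 0 ≤ e n) ∧ Tendsto e atTop (𝓝 0) ∧ ∀ᶠ n : ℕ in atTop, ∀ x y : ℝ,
      |x - n * p| ≤ 2 * (n : ℝ) ^ (3 / 4 : ℝ) → |y - n * p| ≤ 2 * (n : ℝ) ^ (3 / 4 : ℝ) →
        |f x y - f (n * p) (n * p)| ≤ e n * |f (n * p) (n * p)| := by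
  refine exists_null_seq_of_forall_pos (Q := fun n ε => ∀ x y : ℝ,
      |x - n * p| ≤ 2 * (n : ℝ) ^ (3 / 4 : ℝ) → |y - n * p| ≤ 2 * (n : ℝ) ^ (3 / 4 : ℝ) →
        |f x y - f (n * p) (n * p)| ≤ ε * |f (n * p) (n * p)|) ?_ ?_
  · intro n a b hab h x y hx hy
    exact (h x y hx hy).trans (by gcongr)
  · intro ε hε
    -- Pick a counterexample in the window when there is one, and the centre otherwise. Stability
    -- along these chosen sequences rules out counterexamples for large n.
    have key : ∀ n : ℕ, ∃ z : ℝ × ℝ, |z.1 - n * p| ≤ 2 * (n : ℝ) ^ (3 / 4 : ℝ) ∧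
        |z.2 - n * p| ≤ 2 * (n : ℝ) ^ (3 / 4 : ℝ) ∧
        (|f z.1 z.2 - f (n * p) (n * p)| ≤ ε * |f (n * p) (n * p)| → ∀ x y : ℝ,
          |x - n * p| ≤ 2 * (n : ℝ) ^ (3 / 4 : ℝ) → |y - n * p| ≤ 2 * (n : ℝ) ^ (3 / 4 : ℝ) →
            |f x y - f (n * p) (n * p)| ≤ ε * |f (n * p) (n * p)|) := by
      intro n
      by_cases h : ∀ x y : ℝ, |x - n * p| ≤ 2 * (n : ℝ) ^ (3 / 4 : ℝ) →
          |y - n * p| ≤ 2 * (n : ℝ) ^ (3 / 4 : ℝ) →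
            |f x y - f (n * p) (n * p)| ≤ ε * |f (n * p) (n * p)|
      · have h0 : (0 : ℝ) ≤ 2 * (n : ℝ) ^ (3 / 4 : ℝ) := by positivity
        exact ⟨(n * p, n * p), by simpa using h0, by simpa using h0, fun _ => h⟩
      · push Not at h
        obtain ⟨x, y, hx, hy, hlt⟩ := h
        exact ⟨(x, y), hx, hy, fun hle => absurd hle (not_le.2 hlt)⟩
    choose z hz1 hz2 hz using key
    have := (hf (fun n => (z n).1) (fun n => (z n).2) (isEquivalent_mul_of_abs_sub_le hp hz1)
      (isEquivalent_mul_of_abs_sub_le hp hz2)).isLittleO.bound hε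
    filter_upwards [this] with n hn
    exact hz n hn

end WeightedGraph

/-! ### Eigenvalues close to a constant in mean square -/

theorem Matrix.IsHermitian.sum_eigenvalues_sq {n : Type*} [Fintype n] [DecidableEq n]
    {A : Matrix n n ℝ} (hA : A.IsHermitian) :
    ∑ i, hA.eigenvalues i ^ 2 = ∑ i, ∑ j, A i j ^ 2 := by
  have h1 : (A * A).trace = ∑ i, hA.eigenvalues i ^ 2 := by
    conv_lhs => rw [hA.spectral_theorem, ← map_mul, Unitary.conjStarAlgAut_apply,
      Matrix.trace_mul_cycle, Unitary.coe_star_mul_self, one_mul, Matrix.diagonal_mul_diagonal,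
      Matrix.trace_diagonal]
    simp [sq]
  rw [← h1, Matrix.trace]
  refine Finset.sum_congr rfl fun i _ => ?_
  rw [Matrix.diag_apply, Matrix.mul_apply]
  refine Finset.sum_congr rfl fun j _ => ?_
  rw [sq]
  congr 1
  simpa using hA.apply i j

theorem Matrix.IsHermitian.sum_eigenvalues_sub_sq {n : Type*} [Fintype n] [DecidableEq n]
    {A : Matrix n n ℝ} (hA : A.IsHermitian) (m : ℝ) :
    ∑ i, (hA.eigenvalues i - m) ^ 2 =
      ∑ i, ((A i i - m) ^ 2 + ∑ j ∈ Finset.univ.erase i, A i j ^ 2) := by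
  have h1 := hA.sum_eigenvalues_sq
  have h2 : ∑ i, A i i = ∑ i, hA.eigenvalues i := by
    simpa [Matrix.trace] using hA.trace_eq_sum_eigenvalues
  have h3 : ∀ i, (A i i - m) ^ 2 + ∑ j ∈ Finset.univ.erase i, A i j ^ 2 =
      ∑ j, A i j ^ 2 - 2 * m * A i i + m ^ 2 := fun i => by
    rw [← Finset.add_sum_erase _ _ (Finset.mem_univ i)]
    ring
  simp_rw [h3, sub_sq, Finset.sum_add_distrib, Finset.sum_sub_distrib, ← h1, ← Finset.mul_sum, h2]
  congr 2
  rw [Finset.mul_sum]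
  exact Finset.sum_congr rfl fun i _ => by ring

/-- Difference of squares, with √|a| + √|b| ≥ √|b|. Keeping √|b| as a factor avoids dividing by it
when b = 0. -/
theorem abs_sqrt_abs_sub_mul_le (a b : ℝ) : |√|a| - √(|b|)| * √|b| ≤ |a - b| := by
  have h1 : |√|a| - √(|b|)| * (√|a| + √|b|) = |(|a| - |b|)| := by
    rw [← abs_of_nonneg (by positivity : 0 ≤ √|a| + √|b|), ← abs_mul]
    congr 1
    nlinarith [Real.sq_sqrt (abs_nonneg a), Real.sq_sqrt (abs_nonneg b)]
  calc _ ≤ |√|a| - √(|b|)| * (√|a| + √|b|) := by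
        gcongr
        linarith [Real.sqrt_nonneg |a|]
    _ ≤ _ := h1 ▸ abs_abs_sub_abs_le a b

/-- If the points `x i` are close to `m` in mean square, then `∑ √|x i|` is close to `n √|m|`. -/
theorem sq_sum_sqrt_abs_sub_mul_le {ι : Type*} [Fintype ι] (x : ι → ℝ) (m : ℝ) :
    (∑ i, √|x i| - Fintype.card ι * √|m|) ^ 2 * |m| ≤ Fintype.card ι * ∑ i, (x i - m) ^ 2 := by
  have h1 : (∑ i, √|x i| - Fintype.card ι * √|m|) * √|m| = ∑ i, (√|x i| - √|m|) * √|m| := by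
    rw [← Finset.sum_mul, Finset.sum_sub_distrib]
    simp
  calc _ = ((∑ i, √|x i| - Fintype.card ι * √|m|) * √|m|) ^ 2 := by
        rw [mul_pow, Real.sq_sqrt (abs_nonneg m)]
    _ = (∑ i, (√|x i| - √|m|) * √|m|) ^ 2 := by rw [h1]
    _ ≤ Fintype.card ι * ∑ i, ((√|x i| - √|m|) * √|m|) ^ 2 := by
        simpa using sq_sum_le_card_mul_sum_sq (s := Finset.univ)
          (f := fun i => (√|x i| - √|m|) * √|m|)
    _ ≤ _ := by
        refine mul_le_mul_of_nonneg_left (Finset.sum_le_sum fun i _ => ?_) (Nat.cast_nonneg _)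
        rw [sq_le_sq, abs_mul, abs_of_nonneg (Real.sqrt_nonneg |m|)]
        exact abs_sqrt_abs_sub_mul_le _ _

/-- A Hermitian matrix whose diagonal is nearly constant and whose off-diagonal entries are of
smaller order has nearly all its eigenvalues close to that constant, on the square-root scale. -/
theorem Matrix.IsHermitian.abs_sum_sqrt_eigenvalues_sub_le {n : ℕ} (hn : 0 < n)
    {A : Matrix (Fin n) (Fin n) ℝ} (hA : A.IsHermitian) {F p a b : ℝ} (hp : 0 < p)
    (hdiag : ∀ i, |A i i - F * (n * p)| ≤ |F| * n * a)
    (hoff : ∀ i j, i ≠ j → |A i j| ≤ |F| * b) :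
    |∑ i, √|hA.eigenvalues i| - √|F| * √p * (n : ℝ) ^ (3 / 2 : ℝ)| ≤
      √|F| * √((a ^ 2 + b ^ 2 / n) / p) * (n : ℝ) ^ (3 / 2 : ℝ) := by
  have hn' : (0 : ℝ) < n := by exact_mod_cast hn
  set m := F * (n * p) with hm
  have hS : ∑ i, (hA.eigenvalues i - m) ^ 2 ≤ F ^ 2 * n ^ 3 * (a ^ 2 + b ^ 2 / n) := by
    rw [hA.sum_eigenvalues_sub_sq m]
    calc _ ≤ ∑ i : Fin n, ((|F| * n * a) ^ 2 +
          ∑ j ∈ Finset.univ.erase i, (|F| * b) ^ 2) := by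
          refine Finset.sum_le_sum fun i _ => add_le_add ?_ (Finset.sum_le_sum fun j hj => ?_)
          · exact sq_le_sq.2 ((hdiag i).trans (le_abs_self _))
          · exact sq_le_sq.2 ((hoff i j (Finset.ne_of_mem_erase hj).symm).trans (le_abs_self _))
      _ ≤ ∑ i : Fin n, ((|F| * n * a) ^ 2 + ∑ j : Fin n, (|F| * b) ^ 2) := by
          gcongr with i
          exact Finset.erase_subset _ _
      _ = _ := by
          simp only [Finset.sum_const, Finset.card_univ, Fintype.card_fin, nsmul_eq_mul]
          simp only [mul_pow, sq_abs]
          field_simp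
  -- When F = 0 the factor |m| cannot be cancelled, but then `hS` forces every eigenvalue to vanish.
  by_cases hF : F = 0
  · have h0 : ∀ i, hA.eigenvalues i = 0 := by
      have h1 : ∑ i, (hA.eigenvalues i - m) ^ 2 = 0 :=
        le_antisymm (hS.trans (by simp [hF])) (by positivity)
      intro i
      have := (Finset.sum_eq_zero_iff_of_nonneg fun i _ => sq_nonneg _).1 h1 i (Finset.mem_univ i)
      simpa [hm, hF] using this
    simp [h0, hF]
  · have hF' : 0 < |F| := abs_pos.2 hF
    have hpow : (n : ℝ) ^ (3 / 2 : ℝ) = n * √n := by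
      rw [Real.sqrt_eq_rpow, ← Real.rpow_one_add' hn'.le (by norm_num)]
      norm_num
    have hroot : √|F| * √p * (n : ℝ) ^ (3 / 2 : ℝ) = n * √|m| := by
      rw [hm, abs_mul, abs_of_pos (mul_pos hn' hp), Real.sqrt_mul (abs_nonneg F),
        Real.sqrt_mul hn'.le, hpow]
      ring
    have hq := sq_sum_sqrt_abs_sub_mul_le hA.eigenvalues m
    rw [Fintype.card_fin] at hq
    rw [hroot]
    refine abs_le_of_sq_le_sq ?_ (by positivity)
    have hm0 : |m| = |F| * n * p := by
      rw [hm, abs_mul, abs_of_pos (mul_pos hn' hp), mul_assoc]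
    have hm' : 0 < |m| := by rw [hm0]; positivity
    rw [mul_pow, mul_pow, Real.sq_sqrt hF'.le, Real.sq_sqrt (by positivity), hpow, mul_pow,
      Real.sq_sqrt hn'.le]
    refine le_of_mul_le_mul_right (hq.trans ((mul_le_mul_of_nonneg_left hS hn'.le).trans_eq ?_)) hm'
    rw [hm0, ← sq_abs F]
    field_simp

/-! ### Entry bounds and the asymptotics -/

namespace WeightedGraph

theorem adjMatrix_self {V : Type*} [Fintype V] (f : ℝ → ℝ → ℝ) (G : SimpleGraph V) (i : V) :
    adjMatrix f G i i = 0 := by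
  simp [adjMatrix]

variable {f : ℝ → ℝ → ℝ} {n : ℕ} {G : SimpleGraph (Fin n)} {F e : ℝ}

open Classical in
theorem abs_adjMatrix_le (he : 0 ≤ e)
    (h : ∀ i j, |f (G.degree i) (G.degree j) - F| ≤ e * |F|) (i j : Fin n) :
    |adjMatrix f G i j| ≤ |F| * (1 + e) := by
  simp only [adjMatrix, Matrix.of_apply]
  split_ifs
  · have h1 := h i j
    have h2 := abs_add_le (f (G.degree i) (G.degree j) - F) F
    rw [sub_add_cancel] at h2
    linarith
  · rw [abs_zero]
    positivity

-- Two errors add up: replacing each weight by F costs at most e|F| per entry, and replacing the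
-- degree by np costs |F|nc.
open Classical in
theorem abs_sum_adjMatrix_sub_le {p c : ℝ} (he : 0 ≤ e)
    (h : ∀ i j, |f (G.degree i) (G.degree j) - F| ≤ e * |F|) (i : Fin n)
    (hdeg : |(G.degree i : ℝ) - n * p| ≤ n * c) :
    |∑ j, adjMatrix f G i j - F * (n * p)| ≤ |F| * n * (e + c) := by
  have h1 : |∑ j, (adjMatrix f G i j - if G.Adj i j then F else 0)| ≤ n * (e * |F|) := by
    refine (Finset.abs_sum_le_sum_abs _ _).trans ?_
    refine (Finset.sum_le_card_nsmul _ _ (e * |F|) fun j _ => ?_).trans (by simp)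
    simp only [adjMatrix, Matrix.of_apply]
    split_ifs
    · exact h i j
    · simp only [sub_self, abs_zero]
      positivity
  have h2 : ∑ j, (if G.Adj i j then F else 0) = G.degree i * F := by
    rw [← Finset.sum_filter, Finset.sum_const, nsmul_eq_mul,
      ← SimpleGraph.neighborFinset_eq_filter, SimpleGraph.card_neighborFinset_eq_degree]
  rw [Finset.sum_sub_distrib, h2] at h1
  have h3 : |G.degree i * F - F * (n * p)| ≤ |F| * (n * c) := by
    rw [mul_comm, ← mul_sub, abs_mul]
    gcongr
  calc _ ≤ _ := abs_sub_le _ (G.degree i * F) _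
    _ ≤ n * (e * |F|) + |F| * (n * c) := add_le_add h1 h3
    _ = _ := by ring

/-- Any energy that is the sum of the square roots of the absolute eigenvalues of `D_f ± A_f`
has the asymptotics `√|f(np, np)| (√p + o(1)) n^{3/2}` for almost all graphs. -/
theorem hasAsymptotics_of_abs_sub_le {f : ℝ → ℝ → ℝ} {p : unitInterval} (hp : 0 < (p : ℝ))
    (hf : StableAt f p)
    {A : (n : ℕ) → SimpleGraph (Fin n) → Matrix (Fin n) (Fin n) ℝ}
    (hA : ∀ n G, (A n G).IsHermitian)
    (hdiag : ∀ n G i, A n G i i = ∑ j, adjMatrix f G i j)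
    (hoff : ∀ n G i j, i ≠ j → |A n G i j| = |adjMatrix f G i j|) :
    HasAsymptotics f p fun n G => ∑ i, √|(hA n G).eigenvalues i| := by
  classical
  obtain ⟨e, he0, he, hfe⟩ := hf.exists_uniform hp
  set c : ℕ → ℝ := fun n => 2 * (n : ℝ) ^ (-(1 / 4) : ℝ) with hc
  refine ⟨fun n => √(((e n + c n) ^ 2 + (1 + e n) ^ 2 / n) / p), ?_, ?_⟩
  · have hc0 : Tendsto c atTop (𝓝 0) := by
      have := ((tendsto_rpow_neg_atTop (by norm_num : (0 : ℝ) < 1 / 4)).comp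
        tendsto_natCast_atTop_atTop).const_mul 2
      rw [mul_zero] at this
      exact this
    have h1 := ((((he.add hc0).pow 2).add (((he.const_add 1).pow 2).div_atTop
      tendsto_natCast_atTop_atTop)).div_const (p : ℝ)).sqrt
    simpa using h1
  · refine (almostAll_nearRegular p).mono_eventually ?_
    filter_upwards [hfe, eventually_gt_atTop 0] with n hfn hn G hG
    have hn' : (0 : ℝ) < n := by exact_mod_cast hn
    have hw : ∀ i j, |f (G.degree i) (G.degree j) - f (n * p) (n * p)| ≤
        e n * |f (n * p) (n * p)| := fun i j => hfn _ _ (by convert hG i) (by convert hG j)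
    have hnc : 2 * (n : ℝ) ^ (3 / 4 : ℝ) = n * c n := by
      rw [hc, mul_left_comm, ← Real.rpow_one_add' hn'.le (by norm_num)]
      norm_num
    have key := (hA n G).abs_sum_sqrt_eigenvalues_sub_le hn (F := f (n * p) (n * p))
      (a := e n + c n) (b := 1 + e n) hp
      (fun i => by
        rw [hdiag]
        exact abs_sum_adjMatrix_sub_le (he0 n) hw i (hnc ▸ by convert hG i))
      (fun i j hij => by
        rw [hoff n G i j hij]
        exact abs_adjMatrix_le (he0 n) hw i j)
    set S := ∑ i, √|(hA n G).eigenvalues i|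
    set F := f (n * p) (n * p)
    set r := (n : ℝ) ^ (3 / 2 : ℝ)
    have hr : 0 < r := by positivity
    -- If F = 0, `key` makes the energy vanish and any δ fits; otherwise δ is found by solving the
    -- required identity.
    by_cases hF : √|F| = 0
    · refine ⟨0, by simp, ?_⟩
      simpa [hF] using key
    · have hF' : 0 < √|F| := lt_of_le_of_ne (Real.sqrt_nonneg _) (Ne.symm hF)
      refine ⟨(S - √|F| * √(p : ℝ) * r) / (√|F| * r), ?_, ?_⟩
      · rw [abs_div, abs_of_pos (mul_pos hF' hr), div_le_iff₀ (mul_pos hF' hr)]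
        linarith
      · field_simp
        ring

end WeightedGraph

theorem corollary2p7 (p : unitInterval) (hp0 : 0 < (p : ℝ)) (hp1 : (p : ℝ) < 1)
    (f : ℝ → ℝ → ℝ) (hsymm : ∀ x y, f x y = f y x) (hf : WeightedGraph.StableAt f p) :
    WeightedGraph.HasAsymptotics f p (fun _ G => WeightedGraph.LEL f hsymm G) ∧
      WeightedGraph.HasAsymptotics f p (fun _ G => WeightedGraph.IE f hsymm G) := by
  constructor
  · refine WeightedGraph.hasAsymptotics_of_abs_sub_le hp0 hf
      (fun _ G => WeightedGraph.isHermitian_lapMatrix hsymm G) ?_ ?_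
    · intro n G i
      simp [WeightedGraph.lapMatrix, WeightedGraph.degMatrix, WeightedGraph.adjMatrix_self]
    · intro n G i j hij
      simp [WeightedGraph.lapMatrix, WeightedGraph.degMatrix, hij]
  · refine WeightedGraph.hasAsymptotics_of_abs_sub_le hp0 hf
      (fun _ G => WeightedGraph.isHermitian_signlessLapMatrix hsymm G) ?_ ?_
    · intro n G i
      simp [WeightedGraph.signlessLapMatrix, WeightedGraph.degMatrix, WeightedGraph.adjMatrix_self]
    · intro n G i j hij
      simp [WeightedGraph.signlessLapMatrix, WeightedGraph.degMatrix, hij]
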